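/- Let $\mathbb{H}$ be a complex Hilbert space and $n\ge 1$. Let $\mathbb{H}^{\otimes n}$ be the Hilbert space tensor power, with $\langle y_1\otimes\cdots\otimes y_n,\,x_1\otimes\cdots\otimes x_n\rangle=\prod_i\langle y_i,x_i\rangle$, let $U_\pi(x_1\otimes\cdots\otimes x_n)=x_{\pi^{-1}(1)}\otimes\cdots\otimes x_{\pi^{-1}(n)}$ for a permutation $\pi$ of $\{1,\dots,n\}$, and let $\mathbb{H}^{(n)}=\{\psi\in\mathbb{H}^{\otimes n}: U_\pi\psi=\operatorname{sgn}(\pi)\psi\ \text{for all }\pi\}$ be the antisymmetric subspace. Let $D_n$ be an $n$-particle fermionic density operator, i.e. a nonnegative trace class operator on $\mathbb{H}^{(n)}$ with $\operatorname{Tr}D_n=1$, and let $\overline{D_n}=D_n\oplus 0$ be its extension by zero to $\mathbb{H}^{\otimes n}$. Then there is exactly one Hermitian trace class operator $D_{n:1}$ on $\mathbb{H}$ (the one-particle reduced density operator) such that $$\operatorname{Tr}\big((K\otimes I\otimes\cdots\otimes I)\,\overline{D_n}\big)=\operatorname{Tr}(K\,D_{n:1})\qquad\text{for all compact Hermitian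 operators }K\text{ on }\mathbb{H},$$ and its operator norm satisfies $\|D_{n:1}\|\le 1/n$. -/

import Mathlib

namespace FermionRDM

open scoped TensorProduct InnerProductSpace

-- `inner` below is the inner product of `InnerProductSpace`.
attribute [local instance 2000] InnerProductSpace.toInner

/-! ### The algebraic tensor power as an inner product space -/

/-- The algebraic `n`-fold tensor power of a complex vector space `H`. (A separate type, so that it
carries only the inner product norm defined below.) -/
def TensorPow (H : Type*) [AddCommGroup H] [Module ℂ H] (n : ℕ) : Type _ :=
  PiTensorProduct ℂ (fun _ : Fin n => H)

section Algebraic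

variable (H : Type*) [AddCommGroup H] [Module ℂ H]

noncomputable instance TensorPow.instAddCommGroup (n : ℕ) : AddCommGroup (TensorPow H n) :=
  inferInstanceAs (AddCommGroup (PiTensorProduct ℂ (fun _ : Fin n => H)))

noncomputable instance TensorPow.instModule (n : ℕ) : Module ℂ (TensorPow H n) :=
  inferInstanceAs (Module ℂ (PiTensorProduct ℂ (fun _ : Fin n => H)))

/-- The simple tensor `x₁ ⊗ ⋯ ⊗ xₙ`. -/
noncomputable def simpleTensor (n : ℕ) : MultilinearMap ℂ (fun _ : Fin n => H) (TensorPow H n) :=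
  PiTensorProduct.tprod ℂ

/-- The canonical isomorphism `H^{⊗0} ≃ ℂ`. -/
noncomputable def zeroEquiv : TensorPow H 0 ≃ₗ[ℂ] ℂ :=
  PiTensorProduct.isEmptyEquiv (Fin 0)

theorem zeroEquiv_simpleTensor (x : Fin 0 → H) : zeroEquiv H (simpleTensor H 0 x) = 1 :=
  PiTensorProduct.isEmptyEquiv_apply_tprod (Fin 0) x

/-- The canonical isomorphism `H ⊗ H^{⊗n} ≃ H^{⊗(n+1)}`,
`x ⊗ (y₁ ⊗ ⋯ ⊗ yₙ) ↦ x ⊗ y₁ ⊗ ⋯ ⊗ yₙ`. -/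
noncomputable def consEquiv (n : ℕ) : H ⊗[ℂ] TensorPow H n ≃ₗ[ℂ] TensorPow H (n + 1) :=
  (TensorProduct.congr
      (PiTensorProduct.subsingletonEquiv (R := ℂ) (s := fun _ : Fin 1 => H) (0 : Fin 1)).symm
      (LinearEquiv.refl ℂ (PiTensorProduct ℂ (fun _ : Fin n => H)))).trans
    ((PiTensorProduct.tmulEquiv ℂ H).trans
      (PiTensorProduct.reindex ℂ (fun _ => H)
        (finSumFinEquiv.trans (finCongr (Nat.add_comm 1 n)))))

theorem consEquiv_tmul_simpleTensor (n : ℕ) (x : H) (y : Fin n → H) :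
    consEquiv H n (x ⊗ₜ simpleTensor H n y) = simpleTensor H (n + 1) (Fin.cons x y) := by
  have h : (PiTensorProduct.subsingletonEquiv (R := ℂ) (s := fun _ : Fin 1 => H) (0 : Fin 1)).symm x
      = PiTensorProduct.tprod ℂ (fun _ : Fin 1 => x) := by
    rw [LinearEquiv.symm_apply_eq]
    simp
  change PiTensorProduct.reindex ℂ (fun _ => H) (finSumFinEquiv.trans (finCongr (Nat.add_comm 1 n)))
    (PiTensorProduct.tmulEquiv ℂ H
      ((PiTensorProduct.subsingletonEquiv (R := ℂ) (s := fun _ : Fin 1 => H) (0 : Fin 1)).symm x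
        ⊗ₜ PiTensorProduct.tprod ℂ y)) = PiTensorProduct.tprod ℂ (Fin.cons x y)
  rw [h, PiTensorProduct.tmulEquiv_apply, PiTensorProduct.reindex_tprod]
  congr 1
  funext i
  obtain ⟨j, rfl⟩ := (finSumFinEquiv.trans (finCongr (Nat.add_comm 1 n))).surjective i
  rw [Equiv.symm_apply_apply]
  rcases j with j | j
  · have : (finSumFinEquiv.trans (finCongr (Nat.add_comm 1 n))) (Sum.inl j) = 0 := by
      ext; simp
    rw [this]; rfl
  · have : (finSumFinEquiv.trans (finCongr (Nat.add_comm 1 n))) (Sum.inr j) = j.succ := by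
      ext; simp
    rw [this]; rfl

theorem span_simpleTensor (n : ℕ) :
    Submodule.span ℂ (Set.range (simpleTensor H n)) = ⊤ :=
  PiTensorProduct.span_tprod_eq_top

theorem tensorPow_ext {n : ℕ} {V : Type*} [AddCommGroup V] [Module ℂ V]
    {f g : TensorPow H n →ₗ[ℂ] V} (h : ∀ x, f (simpleTensor H n x) = g (simpleTensor H n x)) :
    f = g :=
  LinearMap.ext_on_range (span_simpleTensor H n) h

/-- `U_π (x₁ ⊗ ⋯ ⊗ xₙ) = x_{π⁻¹(1)} ⊗ ⋯ ⊗ x_{π⁻¹(n)}` on the algebraic tensor power. -/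
noncomputable def permAlg {n : ℕ} (π : Equiv.Perm (Fin n)) : TensorPow H n →ₗ[ℂ] TensorPow H n :=
  (PiTensorProduct.reindex ℂ (fun _ => H) π).toLinearMap

theorem permAlg_simpleTensor {n : ℕ} (π : Equiv.Perm (Fin n)) (x : Fin n → H) :
    permAlg H π (simpleTensor H n x) = simpleTensor H n (fun i => x (π⁻¹ i)) :=
  PiTensorProduct.reindex_tprod π x

end Algebraic

/-- The inner product obtained by transport along an injective linear map. -/
@[reducible] noncomputable def pullbackCore {V W : Type*} [AddCommGroup V] [Module ℂ V] [NormedAddCommGroup W]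
    [InnerProductSpace ℂ W] (f : V →ₗ[ℂ] W) (hf : Function.Injective f) :
    InnerProductSpace.Core ℂ V where
  inner x y := inner ℂ (f x) (f y)
  conj_inner_symm x y := inner_conj_symm _ _
  re_inner_nonneg x := inner_self_nonneg
  add_left x y z := by rw [map_add, inner_add_left]
  smul_left x y r := by rw [map_smul, inner_smul_left]
  definite x hx := hf (by simpa using hx)

section Pre

variable (H : Type*) [NormedAddCommGroup H] [InnerProductSpace ℂ H]

/-- The inner product on `H^{⊗n}`, by recursion on `n` along `H^{⊗0} ≃ ℂ` and
`H^{⊗(n+1)} ≃ H ⊗ H^{⊗n}`; by `inner_simpleTensor` below it is the one with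
`⟪y₁ ⊗ ⋯ ⊗ yₙ, x₁ ⊗ ⋯ ⊗ xₙ⟫ = ⟪y₁, x₁⟫ ⋯ ⟪yₙ, xₙ⟫`. -/
@[reducible] noncomputable def tensorCore : ∀ n : ℕ, InnerProductSpace.Core ℂ (TensorPow H n)
  | 0 => pullbackCore (zeroEquiv H).toLinearMap (zeroEquiv H).injective
  | n + 1 =>
    letI := tensorCore n
    letI : NormedAddCommGroup (TensorPow H n) :=
      InnerProductSpace.Core.toNormedAddCommGroup (𝕜 := ℂ)
    letI : InnerProductSpace ℂ (TensorPow H n) := InnerProductSpace.ofCore _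
    pullbackCore (consEquiv H n).symm.toLinearMap (consEquiv H n).symm.injective

noncomputable instance TensorPow.instNormedAddCommGroup (n : ℕ) :
    NormedAddCommGroup (TensorPow H n) :=
  letI := tensorCore H n
  InnerProductSpace.Core.toNormedAddCommGroup (𝕜 := ℂ)

noncomputable instance TensorPow.instInnerProductSpace (n : ℕ) :
    InnerProductSpace ℂ (TensorPow H n) :=
  letI := tensorCore H n
  InnerProductSpace.ofCore _

theorem inner_zero_eq (x y : TensorPow H 0) :
    inner ℂ x y = inner ℂ (zeroEquiv H x) (zeroEquiv H y) := rfl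

theorem inner_succ_eq (n : ℕ) (x y : TensorPow H (n + 1)) :
    inner ℂ x y = inner ℂ ((consEquiv H n).symm x) ((consEquiv H n).symm y) := rfl

theorem inner_simpleTensor (n : ℕ) (x y : Fin n → H) :
    inner ℂ (simpleTensor H n x) (simpleTensor H n y) = ∏ i, inner ℂ (x i) (y i) := by
  induction n with
  | zero => simp [inner_zero_eq, zeroEquiv_simpleTensor]
  | succ n ih =>
    have h : ∀ z : Fin (n + 1) → H, (consEquiv H n).symm (simpleTensor H (n + 1) z) =
        z 0 ⊗ₜ simpleTensor H n (Fin.tail z) := by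
      intro z
      rw [LinearEquiv.symm_apply_eq, consEquiv_tmul_simpleTensor, Fin.cons_self_tail]
    rw [inner_succ_eq, h, h, TensorProduct.inner_tmul, ih, Fin.prod_univ_succ]
    rfl

/-- `H ⊗ H^{⊗n} ≃ H^{⊗(n+1)}` as an isometry. -/
noncomputable def consIsometry (n : ℕ) : H ⊗[ℂ] TensorPow H n ≃ₗᵢ[ℂ] TensorPow H (n + 1) :=
  (consEquiv H n).isometryOfInner fun x y => by simp [inner_succ_eq]

theorem inner_permAlg {n : ℕ} (π : Equiv.Perm (Fin n)) (x y : TensorPow H n) :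
    inner ℂ (permAlg H π x) (permAlg H π y) = inner ℂ x y := by
  have key : ∀ (a : Fin n → H) (y : TensorPow H n),
      inner ℂ (permAlg H π (simpleTensor H n a)) (permAlg H π y) =
        inner ℂ (simpleTensor H n a) y := by
    intro a y
    have : (innerₛₗ ℂ (permAlg H π (simpleTensor H n a))).comp (permAlg H π) =
        innerₛₗ ℂ (simpleTensor H n a) := by
      refine tensorPow_ext H fun b => ?_
      simp only [LinearMap.comp_apply, innerₛₗ_apply_apply, permAlg_simpleTensor,
        inner_simpleTensor]
      exact Equiv.prod_comp π⁻¹ fun i => inner ℂ (a i) (b i)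
    exact congr($this y)
  rw [← inner_conj_symm, ← inner_conj_symm x y]
  congr 1
  have : (innerₛₗ ℂ (permAlg H π y)).comp (permAlg H π) = innerₛₗ ℂ y := by
    refine tensorPow_ext H fun a => ?_
    simp only [LinearMap.comp_apply, innerₛₗ_apply_apply]
    rw [← inner_conj_symm, key, inner_conj_symm]
  exact congr($this x)

end Pre

variable {H : Type*} [NormedAddCommGroup H] [InnerProductSpace ℂ H]

/-! ### The Hilbert tensor power and its antisymmetric subspace -/

variable (H) in
/-- The Hilbert space `H^{⊗n}`: the completion of the algebraic tensor power. -/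
abbrev HilbertTensorPow (n : ℕ) : Type _ := UniformSpace.Completion (TensorPow H n)

/-- The operator `U_π` on `H^{⊗n}`, the continuous extension of `permAlg`. -/
noncomputable def permOp {n : ℕ} (π : Equiv.Perm (Fin n)) :
    HilbertTensorPow H n →L[ℂ] HilbertTensorPow H n :=
  ((permAlg H π).isometryOfInner (inner_permAlg H π)).toContinuousLinearMap.completion

theorem permOp_simpleTensor {n : ℕ} (π : Equiv.Perm (Fin n)) (x : Fin n → H) :
    permOp π (simpleTensor H n x : HilbertTensorPow H n) =
      (simpleTensor H n (fun i => x (π⁻¹ i)) : HilbertTensorPow H n) := by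
  rw [← permAlg_simpleTensor]
  exact ContinuousLinearMap.completion_apply_coe _ _

variable (H) in
/-- The antisymmetric subspace `H^{(n)}` of `H^{⊗n}`. -/
def antisymmetric (n : ℕ) : Submodule ℂ (HilbertTensorPow H n) where
  carrier := {ψ | ∀ π : Equiv.Perm (Fin n), permOp π ψ = ((Equiv.Perm.sign π : ℤ) : ℂ) • ψ}
  add_mem' := fun ha hb π => by rw [map_add, ha π, hb π, smul_add]
  zero_mem' := fun π => by simp
  smul_mem' := fun c x hx π => by rw [map_smul, hx π, smul_comm]

theorem isClosed_antisymmetric (n : ℕ) :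
    IsClosed (antisymmetric H n : Set (HilbertTensorPow H n)) := by
  have : (antisymmetric H n : Set (HilbertTensorPow H n)) =
      ⋂ π : Equiv.Perm (Fin n), {ψ | permOp π ψ = ((Equiv.Perm.sign π : ℤ) : ℂ) • ψ} := by
    ext ψ
    simp [antisymmetric]
  rw [this]
  exact isClosed_iInter fun π =>
    isClosed_eq (permOp π).continuous (continuous_const_smul _)

instance instCompleteSpaceAntisymmetric (n : ℕ) : CompleteSpace (antisymmetric H n) :=
  (isClosed_antisymmetric n).completeSpace_coe

/-- The extension `T̄ = T ⊕ 0` of an operator `T` on `H^{(n)}` to `H^{⊗n}`: first project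
orthogonally onto `H^{(n)}`, then apply `T`. -/
noncomputable def extendByZero {n : ℕ} (T : antisymmetric H n →L[ℂ] antisymmetric H n) :
    HilbertTensorPow H n →L[ℂ] HilbertTensorPow H n :=
  (antisymmetric H n).subtypeL ∘L T ∘L (antisymmetric H n).orthogonalProjectionOnto

/-! ### The operator `K ⊗ I ⊗ ⋯ ⊗ I` -/

/-- `K ⊗ I ⊗ ⋯ ⊗ I` on the algebraic tensor power. -/
noncomputable def onFirstAlg (n : ℕ) (K : H →L[ℂ] H) :
    TensorPow H (n + 1) →L[ℂ] TensorPow H (n + 1) :=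
  (consIsometry H n).toContinuousLinearEquiv.toContinuousLinearMap ∘L
    (TensorProduct.mapL K (ContinuousLinearMap.id ℂ (TensorPow H n))) ∘L
      (consIsometry H n).symm.toContinuousLinearEquiv.toContinuousLinearMap

theorem onFirstAlg_simpleTensor (n : ℕ) (K : H →L[ℂ] H) (x : H) (y : Fin n → H) :
    onFirstAlg n K (simpleTensor H (n + 1) (Fin.cons x y)) =
      simpleTensor H (n + 1) (Fin.cons (K x) y) := by
  have h (z : H) : consIsometry H n (z ⊗ₜ simpleTensor H n y) =
      simpleTensor H (n + 1) (Fin.cons z y) := consEquiv_tmul_simpleTensor H n z y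
  have h' : (consIsometry H n).symm (simpleTensor H (n + 1) (Fin.cons x y)) =
      x ⊗ₜ simpleTensor H n y := by
    rw [← h, LinearIsometryEquiv.symm_apply_apply]
  change consIsometry H n (TensorProduct.mapL K (ContinuousLinearMap.id ℂ (TensorPow H n))
    ((consIsometry H n).symm (simpleTensor H (n + 1) (Fin.cons x y)))) = _
  rw [h', TensorProduct.mapL_tmul, ContinuousLinearMap.id_apply, h]

/-- `K ⊗ I ⊗ ⋯ ⊗ I` on the Hilbert space `H^{⊗(n+1)}`. -/
noncomputable def onFirst (n : ℕ) (K : H →L[ℂ] H) :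
    HilbertTensorPow H (n + 1) →L[ℂ] HilbertTensorPow H (n + 1) :=
  (onFirstAlg n K).completion

theorem onFirst_simpleTensor (n : ℕ) (K : H →L[ℂ] H) (x : H) (y : Fin n → H) :
    onFirst n K (simpleTensor H (n + 1) (Fin.cons x y) : HilbertTensorPow H (n + 1)) =
      (simpleTensor H (n + 1) (Fin.cons (K x) y) : HilbertTensorPow H (n + 1)) := by
  rw [← onFirstAlg_simpleTensor]
  exact ContinuousLinearMap.completion_apply_coe _ _

/-! ### Trace class operators and density operators -/

section Trace

variable {E : Type*} [NormedAddCommGroup E] [InnerProductSpace ℂ E] [CompleteSpace E]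

variable (E) in
/-- The index set of a fixed Hilbert basis of `E`. -/
def basisIndex : Set E := (exists_hilbertBasis ℂ E).choose

variable (E) in
/-- A fixed Hilbert basis (complete orthonormal system) of `E`. -/
noncomputable def stdHilbertBasis : HilbertBasis (basisIndex E) ℂ E :=
  (exists_hilbertBasis ℂ E).choose_spec.choose

/-- `T` is trace class: `Tr |T| = ∑ᵢ ⟪eᵢ, |T| eᵢ⟫ < ∞`, with `|T| = (T* T)^{1/2}`. -/
def IsTraceClass (T : E →L[ℂ] E) : Prop :=
  Summable fun i => (inner ℂ (stdHilbertBasis E i) (CFC.abs T (stdHilbertBasis E i))).re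

/-- The trace `Tr T = ∑ᵢ ⟪eᵢ, T eᵢ⟫` (meaningful for trace class `T`). -/
noncomputable def trace (T : E →L[ℂ] E) : ℂ :=
  ∑' i, inner ℂ (stdHilbertBasis E i) (T (stdHilbertBasis E i))

/-- A density operator: a nonnegative trace class operator of unit trace. -/
structure IsDensityOperator (D : E →L[ℂ] E) : Prop where
  isPositive : D.IsPositive
  isTraceClass : IsTraceClass D
  trace_eq_one : trace D = 1

end Trace

/-! ### The one-particle reduction -/

/-- `T₁` is the one-particle partial trace `T_{:1}` of the operator `T` on `H^{(n+1)}`, where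
`H^{(1)}` is identified with `H`: the Hermitian trace class operator on `H` with
`Tr ((K ⊗ I ⊗ ⋯ ⊗ I) T̄) = Tr (K T₁)` for all compact Hermitian `K`. -/
structure IsOneParticleReduction [CompleteSpace H] {n : ℕ}
    (T : antisymmetric H (n + 1) →L[ℂ] antisymmetric H (n + 1)) (T₁ : H →L[ℂ] H) : Prop where
  isSelfAdjoint : IsSelfAdjoint T₁
  isTraceClass : IsTraceClass T₁
  trace_eq : ∀ K : H →L[ℂ] H, IsCompactOperator K → IsSelfAdjoint K →
    trace (onFirst n K ∘L extendByZero T) = trace (K ∘L T₁)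

end FermionRDM

/-! A positive trace class `D` is a sum of dyads `|ψᵢ⟩⟨ψᵢ|` with `ψᵢ = √D eᵢ` and `∑ ‖ψᵢ‖² = Tr D =
1`. Hence `Tr (A D̄) = ∑ ⟪ψᵢ, A ψᵢ⟫` (`IsSumOfDyads.trace_comp`), and `F K = ∑ ⟪ψᵢ, (K ⊗ I ⊗ ⋯ ⊗ I)
ψᵢ⟫` is a bounded functional, nonnegative on dyads `|x⟩⟨x|`.

Existence is the duality between compact and trace class operators: `⟪x, T y⟫ = F |y⟩⟨x|` defines a
positive trace class `T`, and `Tr (K T) = F K` holds for rank one `K`, hence by density for compact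
`K` (`trace_comp_ofFunctional`). Uniqueness needs only `K = |x⟩⟨x|`, whose trace condition fixes the
quadratic form.

The norm bound is Pauli's principle. For a unit vector `x`, the projections `P_k = |x⟩⟨x|` on the
`k`-th factor satisfy `P_k P_l ψ = 0` for `k ≠ l` and antisymmetric `ψ`, and all `⟪ψ, P_k ψ⟫` agree.
Thus `∑ P_k` acts in expectation like a projection and `(n + 1) ⟪ψ, P₀ ψ⟫ ≤ ‖ψ‖²`
(`inner_onFirst_rankOne_le`); summing over `ψᵢ` gives `⟪x, T x⟫ ≤ 1 / (n + 1)`. -/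

namespace FermionRDM

open scoped TensorProduct InnerProductSpace InnerProduct ComplexOrder
open InnerProductSpace (rankOne)

attribute [local instance 2000] InnerProductSpace.toInner

/-! ### Expectations in a mixture of vectors -/

section Mixture

variable {ι E : Type*} [NormedAddCommGroup E] [InnerProductSpace ℂ E]

/-- The vector functional `A ↦ ⟪ψ, A ψ⟫`. -/
noncomputable def vectorFunctional (ψ : E) : (E →L[ℂ] E) →L[ℂ] ℂ :=
  innerSL ℂ ψ ∘L ContinuousLinearMap.apply ℂ E ψ

theorem vectorFunctional_apply (ψ : E) (A : E →L[ℂ] E) :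
    vectorFunctional ψ A = inner ℂ ψ (A ψ) := rfl

theorem norm_vectorFunctional_le (ψ : E) : ‖vectorFunctional ψ‖ ≤ ‖ψ‖ ^ 2 := by
  refine ContinuousLinearMap.opNorm_le_bound _ (by positivity) fun A => ?_
  rw [vectorFunctional_apply]
  calc ‖inner ℂ ψ (A ψ)‖ ≤ ‖ψ‖ * ‖A ψ‖ := norm_inner_le_norm _ _
    _ ≤ ‖ψ‖ * (‖A‖ * ‖ψ‖) := by gcongr; exact A.le_opNorm ψ
    _ = ‖ψ‖ ^ 2 * ‖A‖ := by ring

theorem hasSum_tsum_apply {V : Type*} [NormedAddCommGroup V] [NormedSpace ℂ V]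
    {f : ι → V →L[ℂ] ℂ} (hf : Summable fun i => ‖f i‖) (v : V) :
    HasSum (fun i => f i v) ((∑' i, f i) v) :=
  hf.of_norm.hasSum.mapL (ContinuousLinearMap.apply ℂ ℂ v)

/-- The functional `A ↦ ∑ᵢ ⟪ψᵢ, A ψᵢ⟫`, for a square summable family `ψ`. -/
noncomputable def mixture (ψ : ι → E) : (E →L[ℂ] E) →L[ℂ] ℂ :=
  ∑' i, vectorFunctional (ψ i)

theorem hasSum_mixture {ψ : ι → E} (hψ : Summable fun i => ‖ψ i‖ ^ 2) (A : E →L[ℂ] E) :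
    HasSum (fun i => inner ℂ (ψ i) (A (ψ i))) (mixture ψ A) := by
  simpa only [mixture, vectorFunctional_apply] using hasSum_tsum_apply
    (.of_nonneg_of_le (fun i => ContinuousLinearMap.opNorm_nonneg _)
      (fun i => norm_vectorFunctional_le (ψ i)) hψ) A

/-- `T = ∑ᵢ |ψᵢ⟩⟨ψᵢ|`, in the weak sense. -/
def IsSumOfDyads (T : E →L[ℂ] E) (ψ : ι → E) : Prop :=
  ∀ x y, HasSum (fun i => inner ℂ x (ψ i) * inner ℂ (ψ i) y) (inner ℂ x (T y))

theorem hasSum_norm_inner_sq (b : HilbertBasis ι ℂ E) (x : E) :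
    HasSum (fun i => ‖inner ℂ (b i) x‖ ^ 2) (‖x‖ ^ 2) := by
  have h := (b.hasSum_inner_mul_inner x x).mapL Complex.reCLM
  have e (i : ι) : Complex.reCLM (inner ℂ x (b i) * inner ℂ (b i) x) = ‖inner ℂ (b i) x‖ ^ 2 := by
    rw [← inner_conj_symm x (b i), Complex.conj_mul']
    simp [← Complex.ofReal_pow]
  simp only [e] at h
  rwa [show Complex.reCLM (inner ℂ x x) = ‖x‖ ^ 2 from
    inner_self_eq_norm_sq (𝕜 := ℂ) x] at h

variable [CompleteSpace E]

/-- Fubini for `⟪ψᵢ, bⱼ⟫ ⟪bⱼ, A ψᵢ⟫`: summing over `j` is Parseval, and summing over `i` gives the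
diagonal entries of `A T`. -/
theorem IsSumOfDyads.trace_comp {T : E →L[ℂ] E} {ψ : ι → E} (hT : IsSumOfDyads T ψ)
    (hψ : Summable fun i => ‖ψ i‖ ^ 2) (A : E →L[ℂ] E) :
    trace (A ∘L T) = mixture ψ A := by
  set b := stdHilbertBasis E
  let f : ι → basisIndex E → ℂ := fun i j => inner ℂ (ψ i) (b j) * inner ℂ (b j) (A (ψ i))
  have hrow (i : ι) : HasSum (f i) (inner ℂ (ψ i) (A (ψ i))) := b.hasSum_inner_mul_inner _ _
  have hcol (j : basisIndex E) : HasSum (fun i => f i j) (inner ℂ (b j) ((A ∘L T) (b j))) := by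
    have h := hT (A.adjoint (b j)) (b j)
    simp only [ContinuousLinearMap.adjoint_inner_left] at h
    exact h.congr_fun fun i => mul_comm _ _
  have hg (i : ι) : HasSum (fun j => ‖inner ℂ (b j) (ψ i)‖ ^ 2 + ‖inner ℂ (b j) (A (ψ i))‖ ^ 2)
      (‖ψ i‖ ^ 2 + ‖A (ψ i)‖ ^ 2) := (hasSum_norm_inner_sq b _).add (hasSum_norm_inner_sq b _)
  have hg' : Summable fun p : ι × basisIndex E =>
      ‖inner ℂ (b p.2) (ψ p.1)‖ ^ 2 + ‖inner ℂ (b p.2) (A (ψ p.1))‖ ^ 2 := by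
    refine (summable_prod_of_nonneg fun p => by positivity).2 ⟨fun i => (hg i).summable, ?_⟩
    simp only [(hg _).tsum_eq]
    refine hψ.add (.of_nonneg_of_le (fun i => by positivity) (fun i => ?_)
      (hψ.mul_left (‖A‖ ^ 2)))
    rw [← mul_pow]
    gcongr
    exact A.le_opNorm _
  have hf : Summable (Function.uncurry f) := by
    refine .of_norm_bounded hg' fun p => ?_
    simp only [Function.uncurry, f, norm_mul]
    rw [norm_inner_symm (ψ p.1) (b p.2)]
    -- Absolute summability comes from `a b ≤ a² + b²`.
    nlinarith [sq_nonneg (‖inner ℂ (b p.2) (ψ p.1)‖ - ‖inner ℂ (b p.2) (A (ψ p.1))‖),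
      sq_nonneg (‖inner ℂ (b p.2) (ψ p.1)‖ + ‖inner ℂ (b p.2) (A (ψ p.1))‖)]
  have h := hf.tsum_comm
  simp only [(hrow _).tsum_eq, (hcol _).tsum_eq] at h
  rw [(hasSum_mixture hψ A).tsum_eq] at h
  exact h

theorem exists_isSumOfDyads {T : E →L[ℂ] E} (hT : T.IsPositive) :
    ∃ ψ : basisIndex E → E, IsSumOfDyads T ψ ∧
      ∀ i, ‖ψ i‖ ^ 2 = (inner ℂ (stdHilbertBasis E i) (T (stdHilbertBasis E i))).re := by
  have h0 : 0 ≤ T := (ContinuousLinearMap.nonneg_iff_isPositive T).2 hT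
  set B := CFC.sqrt T
  have hB (x y : E) : inner ℂ (B x) y = inner ℂ x (B y) :=
    ((ContinuousLinearMap.nonneg_iff_isPositive B).1 (CFC.sqrt_nonneg T)).isSymmetric x y
  have h (x y : E) : inner ℂ x (T y) = inner ℂ (B x) (B y) := by
    rw [hB, ← CFC.sqrt_mul_sqrt_self T h0, mul_apply_eq_comp]
  refine ⟨fun i => B (stdHilbertBasis E i), fun x y => ?_, fun i => ?_⟩
  · rw [h]
    simpa only [hB] using (stdHilbertBasis E).hasSum_inner_mul_inner (B x) (B y)
  · rw [h]
    exact (inner_self_eq_norm_sq (𝕜 := ℂ) _).symm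

theorem IsTraceClass.summable {T : E →L[ℂ] E} (h : IsTraceClass T) (hT : T.IsPositive) :
    Summable fun i => (inner ℂ (stdHilbertBasis E i) (T (stdHilbertBasis E i))).re := by
  have h' := h
  rwa [IsTraceClass, CFC.abs_of_nonneg T ((ContinuousLinearMap.nonneg_iff_isPositive T).2 hT)] at h'

/-- Parseval for `⟪T† y, x⟫`; no trace class assumption is needed, as the product has rank at most
one. -/
theorem trace_rankOne_comp (x y : E) (T : E →L[ℂ] E) :
    trace (rankOne ℂ x y ∘L T) = inner ℂ y (T x) := by
  have h := (stdHilbertBasis E).hasSum_inner_mul_inner (T.adjoint y) x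
  rw [ContinuousLinearMap.adjoint_inner_left] at h
  rw [← h.tsum_eq, trace]
  refine tsum_congr fun i => ?_
  simp [ContinuousLinearMap.adjoint_inner_left, inner_smul_right]

end Mixture

/-! ### Functionals on compact operators -/

section Compact

variable {E : Type*} [NormedAddCommGroup E] [InnerProductSpace ℂ E]

/-- `U` is spanned by a finite `ε`-net of a compact set containing the image of the unit ball; the
projection of `K x` is at least as close to `K x` as the net point is. -/
theorem exists_norm_sub_starProjection_comp_le {K : E →L[ℂ] E} (hK : IsCompactOperator K)
    {ε : ℝ} (hε : 0 < ε) :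
    ∃ U : Submodule ℂ E, ∃ _ : FiniteDimensional ℂ U, ‖K - U.starProjection ∘L K‖ ≤ ε := by
  obtain ⟨S, hS, hKS⟩ := IsCompactOperator.image_closedBall_subset_compact (f := K.toLinearMap) hK 1
  obtain ⟨t, ht, hSt⟩ := Metric.totallyBounded_iff.1 hS.totallyBounded ε hε
  have := FiniteDimensional.span_of_finite ℂ ht
  refine ⟨Submodule.span ℂ t, this, ?_⟩
  refine ContinuousLinearMap.opNorm_le_of_unit_norm hε.le fun x hx => ?_
  have hx : K x ∈ S := hKS ⟨x, by simp [hx], rfl⟩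
  obtain ⟨y, hy, hxy⟩ := Set.mem_iUnion₂.1 (hSt hx)
  simp only [sub_apply, ContinuousLinearMap.comp_apply]
  refine le_trans ?_ (mem_ball_iff_norm.1 hxy).le
  rw [Submodule.starProjection_minimal]
  exact ciInf_le ⟨0, by rintro _ ⟨z, rfl⟩; positivity⟩
    (⟨y, Submodule.subset_span hy⟩ : Submodule.span ℂ t)

/-- This is Bessel's inequality. -/
theorem norm_sum_rankOne_le {ι : Type*} {v : ι → E} (hv : Orthonormal ℂ v) (s : Finset ι) :
    ‖∑ i ∈ s, rankOne ℂ (v i) (v i)‖ ≤ 1 := by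
  refine ContinuousLinearMap.opNorm_le_bound _ zero_le_one fun x => ?_
  rw [one_mul, ← sq_le_sq₀ (norm_nonneg _) (norm_nonneg _)]
  refine le_trans (le_of_eq ?_) (hv.sum_inner_products_le x (s := s))
  rw [← Complex.ofReal_inj, Complex.ofReal_pow, ← RCLike.ofReal_eq_complex_ofReal,
    ← inner_self_eq_norm_sq_to_K]
  simp only [sum_apply, InnerProductSpace.rankOne_apply]
  rw [hv.inner_sum, RCLike.ofReal_eq_complex_ofReal, Complex.ofReal_sum]
  exact Finset.sum_congr rfl fun i _ => by rw [Complex.conj_mul', Complex.ofReal_pow]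

variable [CompleteSpace E]

theorem eq_on_compact_of_eq_on_rankOne {F G : (E →L[ℂ] E) →L[ℂ] ℂ}
    (h : ∀ x y, F (rankOne ℂ x y) = G (rankOne ℂ x y)) {K : E →L[ℂ] E}
    (hK : IsCompactOperator K) : F K = G K := by
  rw [← sub_eq_zero, ← norm_le_zero_iff]
  refine le_of_forall_pos_le_add fun ε hε => ?_
  -- The `+ 1` keeps the divisor positive when `F = G`.
  have hc : 0 < ‖F - G‖ + 1 := by positivity
  obtain ⟨U, _, hU⟩ := exists_norm_sub_starProjection_comp_le hK (div_pos hε hc)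
  have h0 : (F - G) (U.starProjection ∘L K) = 0 := by
    rw [(stdOrthonormalBasis ℂ U).starProjection_eq_sum_rankOne,
      ContinuousLinearMap.finsetSum_comp, map_sum]
    refine Finset.sum_eq_zero fun i _ => ?_
    rw [InnerProductSpace.rankOne_comp]
    simp [h]
  have h1 : F K - G K = (F - G) (K - U.starProjection ∘L K) := by
    rw [map_sub, h0, sub_zero]; rfl
  rw [h1, zero_add]
  calc _ ≤ ‖F - G‖ * (ε / (‖F - G‖ + 1)) := (ContinuousLinearMap.le_opNorm _ _).trans (by gcongr)
    _ ≤ (‖F - G‖ + 1) * (ε / (‖F - G‖ + 1)) := by gcongr; linarith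
    _ = ε := by field_simp

/-- The operator `T` with `⟪x, T y⟫ = F |y⟩⟨x|`. -/
noncomputable def ofFunctional (F : (E →L[ℂ] E) →L[ℂ] ℂ) : E →L[ℂ] E :=
  -- The represented operator sits in the left slot of the inner product; the adjoint moves it to
  -- the right.
  (InnerProductSpace.continuousLinearMapOfBilin
    ((ContinuousLinearMap.compL ℂ E (E →L[ℂ] E) ℂ F).comp
      (rankOne ℂ (E := E) (F := E)).flip))†

theorem inner_ofFunctional (F : (E →L[ℂ] E) →L[ℂ] ℂ) (x y : E) :
    inner ℂ x (ofFunctional F y) = F (rankOne ℂ y x) := by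
  rw [ofFunctional, ContinuousLinearMap.adjoint_inner_right,
    InnerProductSpace.continuousLinearMapOfBilin_apply]
  rfl

theorem isPositive_ofFunctional {F : (E →L[ℂ] E) →L[ℂ] ℂ} (hF : ∀ x, 0 ≤ F (rankOne ℂ x x)) :
    (ofFunctional F).IsPositive := by
  refine (ContinuousLinearMap.isPositive_iff_complex _).2 fun x => ?_
  obtain ⟨h1, h2⟩ := Complex.nonneg_iff.1 (hF x)
  rw [← inner_conj_symm, inner_ofFunctional]
  refine ⟨Complex.ext rfl ?_, by simpa using h1⟩
  simpa using h2.symm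

/-- A partial sum of the trace is `F` of a finite rank orthogonal projection, so it is at most
`‖F‖`. -/
theorem isTraceClass_ofFunctional {F : (E →L[ℂ] E) →L[ℂ] ℂ} (hF : ∀ x, 0 ≤ F (rankOne ℂ x x)) :
    IsTraceClass (ofFunctional F) := by
  rw [IsTraceClass, CFC.abs_of_nonneg _
    ((ContinuousLinearMap.nonneg_iff_isPositive _).2 (isPositive_ofFunctional hF))]
  simp only [inner_ofFunctional]
  refine summable_of_sum_le (c := ‖F‖) (fun i => (Complex.nonneg_iff.1 (hF _)).1) fun s => ?_
  rw [← Complex.re_sum, ← map_sum]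
  refine (Complex.re_le_norm _).trans ((F.le_opNorm _).trans ?_)
  exact mul_le_of_le_one_right (norm_nonneg _)
    (norm_sum_rankOne_le (stdHilbertBasis E).orthonormal s)

/-- A dyad decomposition turns the trace into a bounded functional of `K`, so agreement with `F` on
rank one operators suffices. -/
theorem trace_comp_ofFunctional {F : (E →L[ℂ] E) →L[ℂ] ℂ} (hF : ∀ x, 0 ≤ F (rankOne ℂ x x))
    {K : E →L[ℂ] E} (hK : IsCompactOperator K) : trace (K ∘L ofFunctional F) = F K := by
  have hp := isPositive_ofFunctional hF
  obtain ⟨χ, hχ, hn⟩ := exists_isSumOfDyads hp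
  have hs : Summable fun i => ‖χ i‖ ^ 2 := by
    simpa only [hn] using (isTraceClass_ofFunctional hF).summable hp
  rw [hχ.trace_comp hs]
  refine eq_on_compact_of_eq_on_rankOne (fun x y => ?_) hK
  rw [← hχ.trace_comp hs, trace_rankOne_comp, inner_ofFunctional]

end Compact

/-! ### Operators on the first factor -/

section FirstFactor

variable {H : Type*} [NormedAddCommGroup H] [InnerProductSpace ℂ H]

theorem hilbertTensorPow_ext {n : ℕ} {V : Type*} [NormedAddCommGroup V] [NormedSpace ℂ V]
    {f g : HilbertTensorPow H n →L[ℂ] V}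
    (h : ∀ x, f (simpleTensor H n x : HilbertTensorPow H n) =
      g (simpleTensor H n x : HilbertTensorPow H n)) : f = g := by
  have h' : (f ∘L UniformSpace.Completion.toComplL (𝕜 := ℂ)).toLinearMap =
      (g ∘L UniformSpace.Completion.toComplL (𝕜 := ℂ)).toLinearMap := tensorPow_ext H h
  ext ψ
  induction ψ using UniformSpace.Completion.induction_on with
  | hp => exact isClosed_eq f.continuous g.continuous
  | ih a => exact congr($h' a)

theorem onFirst_simpleTensor' (n : ℕ) (K : H →L[ℂ] H) (x : Fin (n + 1) → H) :
    onFirst n K (simpleTensor H (n + 1) x : HilbertTensorPow H (n + 1)) =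
      (simpleTensor H (n + 1) (Function.update x 0 (K (x 0))) : HilbertTensorPow H (n + 1)) := by
  have h := onFirst_simpleTensor n K (x 0) (Fin.tail x)
  rwa [Fin.cons_self_tail, ← Fin.update_cons_zero (x 0), Fin.cons_self_tail] at h

theorem norm_onFirst_le (n : ℕ) (K : H →L[ℂ] H) : ‖onFirst n K‖ ≤ ‖K‖ := by
  refine ContinuousLinearMap.opNorm_le_bound _ (norm_nonneg K) fun ψ => ?_
  induction ψ using UniformSpace.Completion.induction_on with
  | hp => exact isClosed_le (by fun_prop) (by fun_prop)
  | ih a =>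
    rw [onFirst, ContinuousLinearMap.completion_apply_coe, UniformSpace.Completion.norm_coe,
      UniformSpace.Completion.norm_coe]
    change ‖consIsometry H n (TensorProduct.mapL K (ContinuousLinearMap.id ℂ (TensorPow H n))
      ((consIsometry H n).symm a))‖ ≤ _
    rw [LinearIsometryEquiv.norm_map]
    refine (ContinuousLinearMap.le_opNorm _ _).trans ?_
    rw [LinearIsometryEquiv.norm_map]
    gcongr
    refine (TensorProduct.norm_mapL_le _ _).trans ?_
    exact mul_le_of_le_one_right (norm_nonneg _) ContinuousLinearMap.norm_id_le

variable (H) in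
/-- `K ↦ K ⊗ I ⊗ ⋯ ⊗ I` as a continuous linear map. -/
noncomputable def onFirstL (n : ℕ) :
    (H →L[ℂ] H) →L[ℂ] (HilbertTensorPow H (n + 1) →L[ℂ] HilbertTensorPow H (n + 1)) :=
  LinearMap.mkContinuous
    { toFun := onFirst n
      map_add' := fun K L => hilbertTensorPow_ext fun x => by
        simp [onFirst_simpleTensor', UniformSpace.Completion.coe_add]
      map_smul' := fun c K => hilbertTensorPow_ext fun x => by
        simp [onFirst_simpleTensor', UniformSpace.Completion.coe_smul] }
    1 fun K => by simpa using norm_onFirst_le n K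

theorem onFirst_comp (n : ℕ) (K L : H →L[ℂ] H) :
    onFirst n (K ∘L L) = onFirst n K ∘L onFirst n L :=
  hilbertTensorPow_ext fun x => by simp [onFirst_simpleTensor']

theorem inner_onFirst [CompleteSpace H] (n : ℕ) (K : H →L[ℂ] H)
    (φ ψ : HilbertTensorPow H (n + 1)) :
    inner ℂ (onFirst n K φ) ψ = inner ℂ φ (onFirst n (K†) ψ) := by
  have key (x y : Fin (n + 1) → H) :
      inner ℂ (onFirst n K (simpleTensor H (n + 1) x : HilbertTensorPow H (n + 1)))
        (simpleTensor H (n + 1) y : HilbertTensorPow H (n + 1)) =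
      inner ℂ (simpleTensor H (n + 1) x : HilbertTensorPow H (n + 1))
        (onFirst n (K†) (simpleTensor H (n + 1) y : HilbertTensorPow H (n + 1))) := by
    simp only [onFirst_simpleTensor', UniformSpace.Completion.inner_coe, inner_simpleTensor,
      Fin.prod_univ_succ]
    simp [ContinuousLinearMap.adjoint_inner_right]
  have h1 (x : Fin (n + 1) → H) :
      innerSL ℂ (onFirst n K (simpleTensor H (n + 1) x : HilbertTensorPow H (n + 1))) =
      innerSL ℂ (simpleTensor H (n + 1) x : HilbertTensorPow H (n + 1)) ∘L onFirst n (K†) :=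
    hilbertTensorPow_ext fun y => key x y
  have h2 : innerSL ℂ ψ ∘L onFirst n K = innerSL ℂ (onFirst n (K†) ψ) :=
    hilbertTensorPow_ext fun x => by
      have := congr(starRingEnd ℂ ($(h1 x) ψ))
      simpa using this
  have := congr(starRingEnd ℂ ($h2 φ))
  simpa using this

theorem inner_onFirst_nonneg [CompleteSpace H] (n : ℕ) {K : H →L[ℂ] H} (hK : K.IsPositive)
    (ψ : HilbertTensorPow H (n + 1)) : 0 ≤ inner ℂ ψ (onFirst n K ψ) := by
  -- With `K = B* B` the expectation becomes `‖(B ⊗ I ⊗ ⋯ ⊗ I) ψ‖²`.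
  obtain ⟨B, rfl⟩ := CStarAlgebra.nonneg_iff_eq_star_mul_self.1
    ((ContinuousLinearMap.nonneg_iff_isPositive K).2 hK)
  rw [ContinuousLinearMap.mul_def, onFirst_comp, ContinuousLinearMap.comp_apply,
    ContinuousLinearMap.star_eq_adjoint, ← inner_onFirst, inner_self_eq_norm_sq_to_K]
  rw [← RCLike.ofReal_pow]
  exact Complex.zero_le_real.2 (sq_nonneg _)

end FirstFactor

/-! ### Permutations and the occupation bound -/

section Occupation

variable {H : Type*} [NormedAddCommGroup H] [InnerProductSpace ℂ H]

theorem inner_permOp {n : ℕ} (π : Equiv.Perm (Fin n)) (φ ψ : HilbertTensorPow H n) :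
    inner ℂ (permOp π φ) (permOp π ψ) = inner ℂ φ ψ := by
  induction φ, ψ using UniformSpace.Completion.induction_on₂ with
  | hp => exact isClosed_eq (by fun_prop) (by fun_prop)
  | ih a b =>
    have h (c : TensorPow H n) : permOp π (c : HilbertTensorPow H n) =
      (permAlg H π c : HilbertTensorPow H n) := ContinuousLinearMap.completion_apply_coe _ _
    rw [h, h, UniformSpace.Completion.inner_coe, UniformSpace.Completion.inner_coe, inner_permAlg]

theorem permOp_swap_permOp_swap {n : ℕ} (i j : Fin n) (ψ : HilbertTensorPow H n) :
    permOp (Equiv.swap i j) (permOp (Equiv.swap i j) ψ) = ψ := by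
  have : permOp (Equiv.swap i j) ∘L permOp (Equiv.swap i j) =
      ContinuousLinearMap.id ℂ (HilbertTensorPow H n) :=
    hilbertTensorPow_ext fun x => by simp [permOp_simpleTensor]
  exact congr($this ψ)

theorem inner_permOp_swap_left {n : ℕ} (i j : Fin n) (φ ψ : HilbertTensorPow H n) :
    inner ℂ (permOp (Equiv.swap i j) φ) ψ = inner ℂ φ (permOp (Equiv.swap i j) ψ) := by
  rw [← inner_permOp (Equiv.swap i j) φ, permOp_swap_permOp_swap]

/-- The operator `|x⟩⟨x|` acting on the `k`-th factor. -/
noncomputable def dyadOn {n : ℕ} (x : H) (k : Fin (n + 1)) :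
    HilbertTensorPow H (n + 1) →L[ℂ] HilbertTensorPow H (n + 1) :=
  permOp (Equiv.swap 0 k) ∘L onFirst n (rankOne ℂ x x) ∘L permOp (Equiv.swap 0 k)

theorem dyadOn_simpleTensor {n : ℕ} (x : H) (k : Fin (n + 1)) (y : Fin (n + 1) → H) :
    dyadOn x k (simpleTensor H (n + 1) y : HilbertTensorPow H (n + 1)) =
      (inner ℂ x (y k) : ℂ) •
        (simpleTensor H (n + 1) (Function.update y k x) : HilbertTensorPow H (n + 1)) := by
  have h : (fun i => Function.update (fun i => y (Equiv.swap 0 k i)) 0 x (Equiv.swap 0 k i)) =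
      Function.update y k x := by
    funext i
    rcases eq_or_ne i k with rfl | hi
    · simp
    · rw [Function.update_of_ne hi, Function.update_of_ne]
      · simp
      · rwa [Ne, Equiv.swap_apply_eq_iff, Equiv.swap_apply_left]
  simp [dyadOn, permOp_simpleTensor, onFirst_simpleTensor', UniformSpace.Completion.coe_smul, h]

theorem inner_dyadOn [CompleteSpace H] {n : ℕ} (x : H) (k : Fin (n + 1))
    (φ ψ : HilbertTensorPow H (n + 1)) :
    inner ℂ (dyadOn x k φ) ψ = inner ℂ φ (dyadOn x k ψ) := by
  simp [dyadOn, inner_permOp_swap_left, inner_onFirst]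

theorem dyadOn_dyadOn {n : ℕ} {x : H} (hx : ‖x‖ = 1) (k : Fin (n + 1))
    (ψ : HilbertTensorPow H (n + 1)) : dyadOn x k (dyadOn x k ψ) = dyadOn x k ψ := by
  have : dyadOn x k ∘L dyadOn x k = dyadOn (n := n) x k :=
    hilbertTensorPow_ext fun y => by simp [dyadOn_simpleTensor, hx]
  exact congr($this ψ)

/-- Both slots end up holding `x`, so the swap only exchanges the two scalar factors `⟪x, y k⟫` and
`⟪x, y l⟫`. -/
theorem dyadOn_dyadOn_permOp_swap {n : ℕ} (x : H) {k l : Fin (n + 1)} (hkl : k ≠ l)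
    (ψ : HilbertTensorPow H (n + 1)) :
    dyadOn x k (dyadOn x l (permOp (Equiv.swap k l) ψ)) = dyadOn x k (dyadOn x l ψ) := by
  have : dyadOn x k ∘L dyadOn x l ∘L permOp (Equiv.swap k l) = dyadOn (n := n) x k ∘L dyadOn x l :=
    hilbertTensorPow_ext fun y => by
      have h : Function.update (Function.update (fun i => y (Equiv.swap k l i)) l x) k x =
          Function.update (Function.update y l x) k x := by
        funext i
        rcases eq_or_ne i k with rfl | hk
        · simp
        rcases eq_or_ne i l with rfl | hl
        · simp [hk]
        · simp [hk, hl, Equiv.swap_apply_of_ne_of_ne hk hl]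
      simp [dyadOn_simpleTensor, permOp_simpleTensor, hkl, h, smul_smul, mul_comm]
  exact congr($this ψ)

theorem permOp_swap_of_mem_antisymmetric {n : ℕ} {ψ : HilbertTensorPow H n}
    (hψ : ψ ∈ antisymmetric H n) {k l : Fin n} (hkl : k ≠ l) :
    permOp (Equiv.swap k l) ψ = -ψ := by
  have := hψ (Equiv.swap k l)
  simpa [Equiv.Perm.sign_swap hkl] using this

/-- Pauli's exclusion principle: two particles do not occupy the same state. -/
theorem dyadOn_dyadOn_eq_zero {n : ℕ} (x : H) {k l : Fin (n + 1)} (hkl : k ≠ l)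
    {ψ : HilbertTensorPow H (n + 1)} (hψ : ψ ∈ antisymmetric H (n + 1)) :
    dyadOn x k (dyadOn x l ψ) = 0 := by
  have h := dyadOn_dyadOn_permOp_swap x hkl ψ
  rw [permOp_swap_of_mem_antisymmetric hψ hkl, map_neg, map_neg] at h
  have h2 : (2 : ℂ) • dyadOn x k (dyadOn x l ψ) = 0 := by
    rw [two_smul]
    nth_rw 1 [← h]
    exact neg_add_cancel _
  exact (smul_eq_zero.1 h2).resolve_left two_ne_zero

/-- The swap contributes a sign on each side of the inner product, and the two cancel. -/
theorem inner_dyadOn_of_mem_antisymmetric {n : ℕ} (x : H) (k : Fin (n + 1))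
    {ψ : HilbertTensorPow H (n + 1)} (hψ : ψ ∈ antisymmetric H (n + 1)) :
    inner ℂ ψ (dyadOn x k ψ) = inner ℂ ψ (onFirst n (rankOne ℂ x x) ψ) := by
  rw [dyadOn, ContinuousLinearMap.comp_apply, ContinuousLinearMap.comp_apply,
    ← inner_permOp_swap_left]
  rcases eq_or_ne k 0 with rfl | hk
  · have h : permOp (H := H) (Equiv.swap (0 : Fin (n + 1)) 0) = ContinuousLinearMap.id ℂ _ :=
      hilbertTensorPow_ext fun x => by simp [permOp_simpleTensor]
    rw [h]
    simp
  · simp [permOp_swap_of_mem_antisymmetric hψ hk.symm]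

/-- For `v = ∑ P_k ψ`, exclusion removes the cross terms of `‖v‖²`, so `⟪ψ, v⟫ = ‖v‖²`, and
Cauchy–Schwarz gives `‖v‖ ≤ ‖ψ‖`. -/
theorem inner_onFirst_rankOne_le [CompleteSpace H] {n : ℕ} {x : H} (hx : ‖x‖ = 1)
    {ψ : HilbertTensorPow H (n + 1)} (hψ : ψ ∈ antisymmetric H (n + 1)) :
    ((n + 1 : ℕ) : ℝ) * (inner ℂ ψ (onFirst n (rankOne ℂ x x) ψ)).re ≤ ‖ψ‖ ^ 2 := by
  set c := inner ℂ ψ (onFirst n (rankOne ℂ x x) ψ) with hc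
  set v := ∑ k : Fin (n + 1), dyadOn x k ψ with hv
  have h1 : inner ℂ ψ v = (n + 1 : ℕ) * c := by
    simp [hv, inner_sum, inner_dyadOn_of_mem_antisymmetric x _ hψ, ← hc]
  have h2 : inner ℂ v v = (n + 1 : ℕ) * c := by
    have (k : Fin (n + 1)) : inner ℂ (dyadOn x k ψ) v = c := by
      rw [hv, inner_sum, Finset.sum_eq_single k]
      · rw [inner_dyadOn, dyadOn_dyadOn hx, inner_dyadOn_of_mem_antisymmetric x _ hψ]
      · intro l _ hl
        rw [inner_dyadOn, dyadOn_dyadOn_eq_zero x hl.symm hψ, inner_zero_right]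
      · simp
    nth_rw 1 [hv]
    simp [sum_inner, this]
  have h3 : ((n + 1 : ℕ) : ℝ) * c.re = ‖v‖ ^ 2 := by
    rw [← inner_self_eq_norm_sq (𝕜 := ℂ) v, h2]
    simp
  have h4 : ((n + 1 : ℕ) : ℝ) * c.re ≤ ‖ψ‖ * ‖v‖ := by
    have := re_inner_le_norm (𝕜 := ℂ) ψ v
    rw [h1] at this
    simpa using this
  nlinarith [norm_nonneg ψ, norm_nonneg v, sq_nonneg (‖ψ‖ - ‖v‖)]

end Occupation

/-! ### The reduced density operator -/

section Reduction

variable {H : Type*} [NormedAddCommGroup H] [InnerProductSpace ℂ H]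

theorem IsSumOfDyads.extendByZero {ι : Type*} {n : ℕ}
    {T : antisymmetric H n →L[ℂ] antisymmetric H n} {ψ : ι → antisymmetric H n}
    (hT : IsSumOfDyads T ψ) :
    IsSumOfDyads (extendByZero T) fun i => (ψ i : HilbertTensorPow H n) := by
  intro x y
  have h := hT ((antisymmetric H n).orthogonalProjectionOnto x)
    ((antisymmetric H n).orthogonalProjectionOnto y)
  simp only [Submodule.inner_orthogonalProjectionOnto_eq_of_mem_right,
    Submodule.inner_orthogonalProjectionOnto_eq_of_mem_left] at h
  exact h

/-- The functional `K ↦ ∑ᵢ ⟪ψᵢ, (K ⊗ I ⊗ ⋯ ⊗ I) ψᵢ⟫`. -/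
noncomputable def reducedFunctional {ι : Type*} {n : ℕ} (ψ : ι → HilbertTensorPow H (n + 1)) :
    (H →L[ℂ] H) →L[ℂ] ℂ :=
  mixture ψ ∘L onFirstL H n

theorem hasSum_reducedFunctional {ι : Type*} {n : ℕ} {ψ : ι → HilbertTensorPow H (n + 1)}
    (hψ : Summable fun i => ‖ψ i‖ ^ 2) (K : H →L[ℂ] H) :
    HasSum (fun i => inner ℂ (ψ i) (onFirst n K (ψ i))) (reducedFunctional ψ K) :=
  hasSum_mixture hψ (onFirst n K)

variable [CompleteSpace H]

theorem IsOneParticleReduction.unique {n : ℕ}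
    {T : antisymmetric H (n + 1) →L[ℂ] antisymmetric H (n + 1)} {T₁ T₁' : H →L[ℂ] H}
    (h : IsOneParticleReduction T T₁) (h' : IsOneParticleReduction T T₁') : T₁ = T₁' := by
  have key (x : H) : inner ℂ x (T₁ x) = inner ℂ x (T₁' x) := by
    have hc : IsCompactOperator (rankOne ℂ x x) := by
      rw [InnerProductSpace.rankOne_def']
      exact ((isCompactOperator_id (E := ℂ)).comp_clm (innerSL ℂ x)).clm_comp
        (ContinuousLinearMap.toSpanSingleton ℂ x)
    have hs : IsSelfAdjoint (rankOne ℂ x x) :=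
      (InnerProductSpace.isPositive_rankOne_self x).isSelfAdjoint
    rw [← trace_rankOne_comp x x T₁, ← trace_rankOne_comp x x T₁', ← h.trace_eq _ hc hs,
      ← h'.trace_eq _ hc hs]
  -- Complex polarization: the diagonal values determine the operator.
  refine ContinuousLinearMap.coe_injective ((ext_inner_map _ _).1 fun x => ?_)
  have := congr(starRingEnd ℂ $(key x))
  simp only [inner_conj_symm] at this
  exact this

theorem reducedFunctional_rankOne_nonneg {ι : Type*} {n : ℕ}
    {ψ : ι → HilbertTensorPow H (n + 1)} (hψ : Summable fun i => ‖ψ i‖ ^ 2) (x : H) :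
    0 ≤ reducedFunctional ψ (rankOne ℂ x x) :=
  (hasSum_reducedFunctional hψ _).nonneg fun i =>
    inner_onFirst_nonneg n (InnerProductSpace.isPositive_rankOne_self x) (ψ i)

theorem isOneParticleReduction_ofFunctional {ι : Type*} {n : ℕ}
    {T : antisymmetric H (n + 1) →L[ℂ] antisymmetric H (n + 1)}
    {ψ : ι → antisymmetric H (n + 1)} (hT : IsSumOfDyads T ψ)
    (hψ : Summable fun i => ‖(ψ i : HilbertTensorPow H (n + 1))‖ ^ 2) :
    IsOneParticleReduction T
      (ofFunctional (reducedFunctional fun i => (ψ i : HilbertTensorPow H (n + 1)))) where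
  isSelfAdjoint :=
    (isPositive_ofFunctional (reducedFunctional_rankOne_nonneg hψ)).isSelfAdjoint
  isTraceClass := isTraceClass_ofFunctional (reducedFunctional_rankOne_nonneg hψ)
  trace_eq K hK _ := by
    rw [trace_comp_ofFunctional (reducedFunctional_rankOne_nonneg hψ) hK,
      hT.extendByZero.trace_comp hψ]
    rfl

/-- For positive `T`, `‖T‖ ≤ c` amounts to `T ≤ c • 1`, a condition on the quadratic form that
scales from unit vectors. -/
theorem norm_le_of_inner_le {E : Type*} [NormedAddCommGroup E] [InnerProductSpace ℂ E]
    [CompleteSpace E] {T : E →L[ℂ] E} (hT : T.IsPositive) {c : ℝ} (hc : 0 ≤ c)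
    (h : ∀ x, ‖x‖ = 1 → (inner ℂ x (T x)).re ≤ c) : ‖T‖ ≤ c := by
  rw [CStarAlgebra.norm_le_iff_le_algebraMap T hc
    ((ContinuousLinearMap.nonneg_iff_isPositive T).2 hT), ContinuousLinearMap.le_def]
  refine (ContinuousLinearMap.isPositive_def' ).2 ⟨?_, fun x => ?_⟩
  · exact (IsSelfAdjoint.algebraMap _ (IsSelfAdjoint.all c)).sub hT.isSelfAdjoint
  · have hx : (inner ℂ x (T x)).re ≤ c * ‖x‖ ^ 2 := by
      rcases eq_or_ne x 0 with rfl | h0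
      · simp
      have h1 := h ((‖x‖⁻¹ : ℂ) • x) (norm_smul_inv_norm h0)
      rw [map_smul, inner_smul_left, inner_smul_right, ← Complex.ofReal_inv, Complex.conj_ofReal,
        Complex.re_ofReal_mul, Complex.re_ofReal_mul] at h1
      have h2 : 0 < ‖x‖ := norm_pos_iff.2 h0
      calc (inner ℂ x (T x)).re
          = ‖x‖⁻¹ * (‖x‖⁻¹ * (inner ℂ x (T x)).re) * ‖x‖ ^ 2 := by field_simp
        _ ≤ c * ‖x‖ ^ 2 := by gcongr
    have h3 : inner ℂ x ((algebraMap ℝ (E →L[ℂ] E) c - T) x) =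
        ((c * ‖x‖ ^ 2 : ℝ) : ℂ) - inner ℂ x (T x) := by
      rw [sub_apply, inner_sub_right, Algebra.algebraMap_eq_smul_one, smul_apply,
        one_apply_eq_self, inner_smul_right_eq_smul, inner_self_eq_norm_sq_to_K]
      simp
    rw [ContinuousLinearMap.reApplyInnerSelf_apply, inner_re_symm, h3]
    simpa [← Complex.ofReal_pow] using hx

theorem norm_ofFunctional_reducedFunctional_le {ι : Type*} {n : ℕ}
    {ψ : ι → antisymmetric H (n + 1)}
    (hψ : HasSum (fun i => ‖(ψ i : HilbertTensorPow H (n + 1))‖ ^ 2) 1) :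
    ‖ofFunctional (reducedFunctional fun i => (ψ i : HilbertTensorPow H (n + 1)))‖ ≤
      1 / ((n + 1 : ℕ) : ℝ) := by
  refine norm_le_of_inner_le
    (isPositive_ofFunctional (reducedFunctional_rankOne_nonneg hψ.summable)) (by positivity)
    fun x hx => ?_
  rw [inner_ofFunctional, le_div_iff₀' (by positivity)]
  have h := (hasSum_reducedFunctional hψ.summable (rankOne ℂ x x)).mapL Complex.reCLM
  exact hasSum_le (fun i => inner_onFirst_rankOne_le hx (ψ i).2) (h.mul_left ((n + 1 : ℕ) : ℝ)) hψ

theorem IsDensityOperator.exists_isSumOfDyads {E : Type*} [NormedAddCommGroup E]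
    [InnerProductSpace ℂ E] [CompleteSpace E] {D : E →L[ℂ] E} (hD : IsDensityOperator D) :
    ∃ ψ : basisIndex E → E, IsSumOfDyads D ψ ∧ HasSum (fun i => ‖ψ i‖ ^ 2) 1 := by
  obtain ⟨ψ, h, hn⟩ := FermionRDM.exists_isSumOfDyads hD.isPositive
  refine ⟨ψ, h, ?_⟩
  simp only [hn]
  have hs := hD.isTraceClass.summable hD.isPositive
  -- The trace is a complex sum; positivity makes its terms real, so the real sum is also `1`.
  have hre (i : basisIndex E) :
      Complex.ofRealCLM (inner ℂ (stdHilbertBasis E i) (D (stdHilbertBasis E i))).re =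
        inner ℂ (stdHilbertBasis E i) (D (stdHilbertBasis E i)) :=
    Complex.ext rfl (Complex.nonneg_iff.1 (hD.isPositive.inner_nonneg_right _)).2
  have h1 := hs.hasSum.mapL Complex.ofRealCLM
  simp only [hre] at h1
  have h2 := h1.tsum_eq.symm.trans hD.trace_eq_one
  rw [← Complex.ofReal_injective h2]
  exact hs.hasSum

end Reduction

end FermionRDM

theorem mainTheorem6 {H : Type*} [NormedAddCommGroup H] [InnerProductSpace ℂ H] [CompleteSpace H]
    (n : ℕ)
    (D : FermionRDM.antisymmetric H (n + 1) →L[ℂ] FermionRDM.antisymmetric H (n + 1))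
    (hD : FermionRDM.IsDensityOperator D) :
    (∃! D₁ : H →L[ℂ] H, FermionRDM.IsOneParticleReduction D D₁) ∧
      ∀ D₁ : H →L[ℂ] H, FermionRDM.IsOneParticleReduction D D₁ → ‖D₁‖ ≤ 1 / ((n + 1 : ℕ) : ℝ) := by
  obtain ⟨ψ, hψ, hs⟩ := hD.exists_isSumOfDyads
  have h := FermionRDM.isOneParticleReduction_ofFunctional hψ hs.summable
  refine ⟨⟨_, h, fun D₁ h₁ => h₁.unique h⟩, fun D₁ h₁ => ?_⟩
  rw [h₁.unique h]
  exact FermionRDM.norm_ofFunctional_reducedFunctional_le hs
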